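/- Let $L\ge 0$, let $n_0,\dots,n_{L+1}$ be layer widths and let $\gamma>0$. Consider a feedforward network $z_0=x$, $z_{k+1}=\sigma(W_kz_k+b_k)$ for $0\le k<L$, $y=W_Lz_L+b_L$, with weights $W_k\in\mathbb R^{n_{k+1}\times n_k}$, biases $b_k\in\mathbb R^{n_{k+1}}$ and a scalar activation $\sigma$ applied elementwise. The network is said to satisfy the LMI condition with bound $\gamma$ if there are diagonal matrices $\Lambda_k\in\mathbb R^{n_{k+1}\times n_{k+1}}$ ($0\le k<L$) with positive diagonal entries such that $$H=\begin{bmatrix}\gamma I & -\hat W_0^\top & & & \\ -\hat W_0 & 2\Lambda_0 & -\hat W_1^\top & & \\ & \ddots & \ddots & \ddots & \\ & & -\hat W_{L-1} & 2\Lambda_{L-1} & -\hat W_L^\top\\ & & & -\hat W_L & \gamma I\end{bmatrix}\succeq 0,$$ where $\hat W_k=\Lambda_kW_k$ for $0\le k<L$ and $\hat W_L=W_L$ (for $L=0$, $H=\begin{bmatrix}\gamma I&-W_0^\top\\-W_0&\gamma I\end{bmatrix}$). Theorem. The network satisfies the LMI condition with bound $\gamma$ if and only if there exist vectors $d_k\in\mathbb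 R^{n_{k+1}}$ ($0\le k<L$) and matrices $X_k\in\mathbb R^{n_{k+1}\times n_{k+1}}$, $Y_k\in\mathbb R^{n_k\times n_{k+1}}$ ($0\le k\le L$), all unconstrained, such that $$W_k=2\Psi_k^{-1}B_kA_{k-1}^\top\Psi_{k-1},\qquad k=0,\dots,L,$$ where $\Psi_k=\operatorname{diag}(e^{d_k})$ for $0\le k<L$, $\Psi_{-1}=\sqrt{\gamma/2}\,I$, $\Psi_L=\sqrt{2/\gamma}\,I$, $A_{-1}=I$, and, for $0\le k\le L$, $$\begin{bmatrix}A_k^\top\\ B_k^\top\end{bmatrix}=\begin{bmatrix}(I+Z_k)^{-1}(I-Z_k)\\ -2Y_k(I+Z_k)^{-1}\end{bmatrix},\qquad Z_k=X_k-X_k^\top+Y_k^\top Y_k$$ (the matrix $I+Z_k$ is always invertible). In other words, the image of the map $(d,X,Y)\mapsto(W_0,\dots,W_L)$, defined on the whole parameter space, is exactly the set of weights that satisfy the LMI condition with bound $\gamma$. -/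

import Mathlib

open scoped Matrix

noncomputable section

/-- An `L`-layer feedforward network with layer widths `n 0, …, n (L+1)`:
`z_0 = x`, `z_{k+1} = σ(W_k z_k + b_k)` for `k < L`, and `y = W_L z_L + b_L`. -/
structure FeedforwardNetwork (L : ℕ) (n : Fin (L + 2) → ℕ) where
  /-- The weight `W_k`, of size `n_{k+1} × n_k`, for `0 ≤ k ≤ L`. -/
  W : ∀ k : Fin (L + 1), Matrix (Fin (n k.succ)) (Fin (n k.castSucc)) ℝ
  /-- The bias `b_k`. -/
  b : ∀ k : Fin (L + 1), Fin (n k.succ) → ℝ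
  /-- The scalar activation function. -/
  σ : ℝ → ℝ

namespace FeedforwardNetwork

variable {L : ℕ} {n : Fin (L + 2) → ℕ}

/-- The hidden units `z_0, …, z_L` on the input `x`. -/
def hidden (f : FeedforwardNetwork L n) (x : Fin (n 0) → ℝ) (k : Fin (L + 1)) :
    Fin (n k.castSucc) → ℝ :=
  Fin.induction (motive := fun k : Fin (L + 1) => Fin (n k.castSucc) → ℝ) x
    (fun j z i => f.σ ((f.W j.castSucc *ᵥ z + f.b j.castSucc) i)) k

/-- The input-output map of the network. -/
def eval (f : FeedforwardNetwork L n) (x : Fin (n 0) → ℝ) : Fin (n (Fin.last (L + 1))) → ℝ :=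
  f.W (Fin.last L) *ᵥ f.hidden x (Fin.last L) + f.b (Fin.last L)

/-- `Ŵ_k = Λ_k W_k` for `k < L` and `Ŵ_L = W_L`, where `Λ_k = diag(lam k)`. -/
def scaledWeight (f : FeedforwardNetwork L n) (lam : ∀ j : Fin L, Fin (n j.castSucc.succ) → ℝ)
    (k : Fin (L + 1)) : Matrix (Fin (n k.succ)) (Fin (n k.castSucc)) ℝ :=
  Fin.lastCases
    (motive := fun k : Fin (L + 1) => Matrix (Fin (n k.succ)) (Fin (n k.castSucc)) ℝ)
    (f.W (Fin.last L)) (fun j => Matrix.diagonal (lam j) * f.W j.castSucc) k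

end FeedforwardNetwork

namespace LipschitzLMI

variable {L : ℕ} {n : Fin (L + 2) → ℕ}

/-- The diagonal blocks `γI, 2Λ_0, …, 2Λ_{L-1}, γI`. -/
def diagBlock (γ : ℝ) (lam : ∀ j : Fin L, Fin (n j.castSucc.succ) → ℝ) (i : Fin (L + 2)) :
    Matrix (Fin (n i)) (Fin (n i)) ℝ :=
  Fin.cases (motive := fun i : Fin (L + 2) => Matrix (Fin (n i)) (Fin (n i)) ℝ)
    (γ • 1)
    (fun k => Fin.lastCases
      (motive := fun k : Fin (L + 1) => Matrix (Fin (n k.succ)) (Fin (n k.succ)) ℝ)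
      (γ • 1) (fun j => (2 : ℝ) • Matrix.diagonal (lam j)) k) i

/-- The blocks of the matrix whose block in position `(k+1, k)` is `V k` and whose other blocks
vanish. -/
def subdiagBlock (V : ∀ k : Fin (L + 1), Matrix (Fin (n k.succ)) (Fin (n k.castSucc)) ℝ)
    (i j : Fin (L + 2)) : Matrix (Fin (n i)) (Fin (n j)) ℝ :=
  Fin.cases (motive := fun i : Fin (L + 2) => Matrix (Fin (n i)) (Fin (n j)) ℝ)
    0 (fun k => if h : k.castSucc = j then h ▸ V k else 0) i

/-- The block matrix with block `V k` in position `(k+1, k)` and zeros elsewhere. -/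
def subdiag (V : ∀ k : Fin (L + 1), Matrix (Fin (n k.succ)) (Fin (n k.castSucc)) ℝ) :
    Matrix (Σ i : Fin (L + 2), Fin (n i)) (Σ i : Fin (L + 2), Fin (n i)) ℝ :=
  fun p q => subdiagBlock V p.1 q.1 p.2 q.2

/-- The symmetric block tridiagonal matrix `H` with diagonal blocks
`γI, 2Λ_0, …, 2Λ_{L-1}, γI` and blocks `-Ŵ_0, …, -Ŵ_L` below the diagonal. -/
def H (γ : ℝ) (f : FeedforwardNetwork L n) (lam : ∀ j : Fin L, Fin (n j.castSucc.succ) → ℝ) :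
    Matrix (Σ i : Fin (L + 2), Fin (n i)) (Σ i : Fin (L + 2), Fin (n i)) ℝ :=
  Matrix.blockDiagonal' (diagBlock γ lam) - subdiag (f.scaledWeight lam)
    - (subdiag (f.scaledWeight lam))ᵀ

end LipschitzLMI

/-- The network satisfies the LMI with bound `γ`: `H ⪰ 0` for some positive diagonal multipliers
`Λ_0, …, Λ_{L-1}`. -/
def FeedforwardNetwork.SatisfiesLMI {L : ℕ} {n : Fin (L + 2) → ℕ} (f : FeedforwardNetwork L n)
    (γ : ℝ) : Prop :=
  ∃ lam : ∀ j : Fin L, Fin (n j.castSucc.succ) → ℝ,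
    (∀ j i, 0 < lam j i) ∧ (LipschitzLMI.H γ f lam).PosSemidef

section Cayley

variable {m p : Type*} [Fintype m] [DecidableEq m] [Fintype p]

/-- `Z = X - Xᵀ + Yᵀ Y`. -/
def cayleyZ (X : Matrix m m ℝ) (Y : Matrix p m ℝ) : Matrix m m ℝ :=
  X - Xᵀ + Yᵀ * Y

/-- The Cayley transform of the stacked matrix `[X; Y]`. -/
def cayley (X : Matrix m m ℝ) (Y : Matrix p m ℝ) : Matrix (m ⊕ p) m ℝ :=
  Matrix.fromRows ((1 + cayleyZ X Y)⁻¹ * (1 - cayleyZ X Y))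
    ((-2 : ℝ) • (Y * (1 + cayleyZ X Y)⁻¹))

/-- The inverse in the Cayley transform is a genuine one for all `X` and `Y`. -/
theorem isUnit_one_add_cayleyZ (X : Matrix m m ℝ) (Y : Matrix p m ℝ) :
    IsUnit (1 + cayleyZ X Y) := by
  rw [← Matrix.mulVec_injective_iff_isUnit]
  rw [← Matrix.coe_mulVecLin, ← LinearMap.ker_eq_bot, LinearMap.ker_eq_bot']
  intro v hv
  have h : v ⬝ᵥ ((1 + cayleyZ X Y) *ᵥ v) = 0 := by
    rw [← Matrix.mulVecLin_apply, hv, dotProduct_zero]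
  have hX : v ⬝ᵥ (Xᵀ *ᵥ v) = v ⬝ᵥ (X *ᵥ v) := by
    rw [Matrix.mulVec_transpose, dotProduct_comm, ← Matrix.dotProduct_mulVec]
  have hY : v ⬝ᵥ ((Yᵀ * Y) *ᵥ v) = (Y *ᵥ v) ⬝ᵥ (Y *ᵥ v) := by
    rw [← Matrix.mulVec_mulVec, Matrix.dotProduct_mulVec, Matrix.vecMul_transpose]
  rw [cayleyZ, Matrix.add_mulVec, Matrix.add_mulVec, Matrix.sub_mulVec, Matrix.one_mulVec,
    dotProduct_add, dotProduct_add, dotProduct_sub, hX, hY, sub_self, zero_add] at h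
  have h1 : 0 ≤ v ⬝ᵥ v := Finset.sum_nonneg fun i _ => mul_self_nonneg _
  have h2 : 0 ≤ (Y *ᵥ v) ⬝ᵥ (Y *ᵥ v) := Finset.sum_nonneg fun i _ => mul_self_nonneg _
  exact dotProduct_self_eq_zero.mp (by linarith)

end Cayley

/-- The free parameters: vectors `d_k` (`0 ≤ k < L`) of length `n_{k+1}` and matrices
`X_k`, `Y_k` (`0 ≤ k ≤ L`) of sizes `n_{k+1} × n_{k+1}` and `n_k × n_{k+1}`. -/
structure DirectParams (L : ℕ) (n : Fin (L + 2) → ℕ) where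
  d : ∀ j : Fin L, Fin (n j.castSucc.succ) → ℝ
  X : ∀ k : Fin (L + 1), Matrix (Fin (n k.succ)) (Fin (n k.succ)) ℝ
  Y : ∀ k : Fin (L + 1), Matrix (Fin (n k.castSucc)) (Fin (n k.succ)) ℝ

namespace DirectParams

variable {L : ℕ} {n : Fin (L + 2) → ℕ}

/-- `A_k` for `0 ≤ k ≤ L`: the transpose of the upper block of the Cayley transform. -/
def A (θ : DirectParams L n) (k : Fin (L + 1)) : Matrix (Fin (n k.succ)) (Fin (n k.succ)) ℝ :=
  (Matrix.toRows₁ (cayley (θ.X k) (θ.Y k)))ᵀ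

/-- `B_k` for `0 ≤ k ≤ L`: the transpose of the lower block of the Cayley transform. -/
def B (θ : DirectParams L n) (k : Fin (L + 1)) :
    Matrix (Fin (n k.succ)) (Fin (n k.castSucc)) ℝ :=
  (Matrix.toRows₂ (cayley (θ.X k) (θ.Y k)))ᵀ

/-- `Ψ_k = diag(exp d_k)` for `0 ≤ k < L` and `Ψ_L = √(2/γ) I`. -/
def Ψ (γ : ℝ) (θ : DirectParams L n) (k : Fin (L + 1)) :
    Matrix (Fin (n k.succ)) (Fin (n k.succ)) ℝ :=
  Fin.lastCases
    (motive := fun k : Fin (L + 1) => Matrix (Fin (n k.succ)) (Fin (n k.succ)) ℝ)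
    (√(2 / γ) • 1) (fun j => Matrix.diagonal fun i => Real.exp (θ.d j i)) k

/-- `A_{k-1}` for `0 ≤ k ≤ L + 1`, where `A_{-1} = I`. -/
def prevA (θ : DirectParams L n) (k : Fin (L + 2)) : Matrix (Fin (n k)) (Fin (n k)) ℝ :=
  Fin.cases (motive := fun k : Fin (L + 2) => Matrix (Fin (n k)) (Fin (n k)) ℝ)
    1 (fun j => θ.A j) k

/-- `Ψ_{k-1}` for `0 ≤ k ≤ L + 1`, where `Ψ_{-1} = √(γ/2) I`. -/
def prevΨ (γ : ℝ) (θ : DirectParams L n) (k : Fin (L + 2)) :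
    Matrix (Fin (n k)) (Fin (n k)) ℝ :=
  Fin.cases (motive := fun k : Fin (L + 2) => Matrix (Fin (n k)) (Fin (n k)) ℝ)
    (√(γ / 2) • 1) (fun j => θ.Ψ γ j) k

/-- `W_k = 2 Ψ_k⁻¹ B_k A_{k-1}ᵀ Ψ_{k-1}` for `0 ≤ k ≤ L`. -/
def weight (γ : ℝ) (θ : DirectParams L n) (k : Fin (L + 1)) :
    Matrix (Fin (n k.succ)) (Fin (n k.castSucc)) ℝ :=
  (2 : ℝ) • ((θ.Ψ γ k)⁻¹ * θ.B k * (θ.prevA k.castSucc)ᵀ * θ.prevΨ γ k.castSucc)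

end DirectParams

end

/-! Let `Φ_i` be the diagonal square root of half the `i`-th diagonal block of `H`. Under `x_i = Φ_i
z_i` and `Ŵ_k = 2 Φ_{k+1} U_k Φ_k`, the form of `H` is twice `|x_0|² + ∑ (|x_{k+1}|² - 2 x_{k+1} ·
U_k x_k)` (`posSemidef_H_iff`). With `Λ_k = Ψ_k²` the weight formula says exactly `U_k = B_k
A_{k-1}ᵀ` (`weight_eq_iff`), so the question is when the normalized form is nonnegative.

If `A_k A_kᵀ + B_k B_kᵀ = 1` for all `k`, which the Cayley transform guarantees, the form telescopes
to a sum of squares (`chain_form_nonneg`). Conversely, minimize over `x_0, x_1, …` in turn: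
boundedness below forces `U_k = B_k A_{k-1}ᵀ`, and the Schur complement `1 - B_k B_kᵀ` is positive
semidefinite, so it has a square root `A_k` (`exists_chain_factorization`). As `H` may be singular,
pseudoinverses replace inverses.

The Cayley transform reaches only those isometries `[Aᵀ; Bᵀ]` with `1 + Aᵀ` invertible. Choosing the
positive semidefinite root `A_k` meets this condition, so no admissible weight is lost. -/

/-! ### Square roots and pseudoinverses of symmetric matrices. -/

/-- A real positive semidefinite matrix has a positive semidefinite square root. -/
theorem Matrix.PosSemidef.exists_sqrt {m : Type*} [Fintype m] [DecidableEq m]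
    {S : Matrix m m ℝ} (hS : S.PosSemidef) :
    ∃ A : Matrix m m ℝ, A.PosSemidef ∧ A * A = S := by
  set e := Unitary.conjStarAlgAut ℝ (Matrix m m ℝ) hS.isHermitian.eigenvectorUnitary with he
  have h : S = e (Matrix.diagonal hS.isHermitian.eigenvalues) := hS.isHermitian.spectral_theorem
  refine ⟨e (Matrix.diagonal fun i => √(hS.isHermitian.eigenvalues i)), ?_, ?_⟩
  · rw [he, Unitary.conjStarAlgAut_apply]
    exact (Matrix.PosSemidef.diagonal fun i => Real.sqrt_nonneg _).mul_mul_conjTranspose_same _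
  · rw [← map_mul, Matrix.diagonal_mul_diagonal]
    conv_rhs => rw [h]
    simp only [Real.mul_self_sqrt (hS.eigenvalues_nonneg _)]

/-- A real symmetric matrix has a commuting symmetric Moore-Penrose inverse. -/
theorem Matrix.IsHermitian.exists_pseudoinverse {m : Type*} [Fintype m] [DecidableEq m]
    {A : Matrix m m ℝ} (hA : A.IsHermitian) :
    ∃ P : Matrix m m ℝ, Pᵀ = P ∧ A * P * A = A ∧ P * A * P = P ∧ A * P = P * A := by
  set e := Unitary.conjStarAlgAut ℝ (Matrix m m ℝ) hA.eigenvectorUnitary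
  have h : A = e (Matrix.diagonal hA.eigenvalues) := hA.spectral_theorem
  generalize hA.eigenvalues = l at h
  -- The convention `0⁻¹ = 0` makes inverted eigenvalues the Moore-Penrose inverse.
  refine ⟨e (Matrix.diagonal fun i => (l i)⁻¹), ?_, ?_, ?_, ?_⟩
  · rw [← Matrix.conjTranspose_eq_transpose_of_trivial, ← Matrix.star_eq_conjTranspose, ← map_star,
      Matrix.star_eq_conjTranspose, Matrix.diagonal_conjTranspose]
    rfl
  all_goals
    rw [h]
    simp only [← map_mul, Matrix.diagonal_mul_diagonal]
    congr 2
    funext i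
    by_cases hi : l i = 0 <;> simp [hi, mul_comm]

/-! ### Quadratic forms of block matrices. -/

theorem dotProduct_subdiag_mulVec {L : ℕ} {n : Fin (L + 2) → ℕ}
    (V : ∀ k : Fin (L + 1), Matrix (Fin (n k.succ)) (Fin (n k.castSucc)) ℝ)
    (z : (Σ i : Fin (L + 2), Fin (n i)) → ℝ) :
    z ⬝ᵥ (LipschitzLMI.subdiag V *ᵥ z) =
      ∑ k : Fin (L + 1), (fun a => z ⟨k.succ, a⟩) ⬝ᵥ (V k *ᵥ fun a => z ⟨k.castSucc, a⟩) := by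
  simp only [dotProduct, Matrix.mulVec, LipschitzLMI.subdiag, Fintype.sum_sigma]
  rw [Fin.sum_univ_succ]
  have h0 : ∀ (j : Fin (L + 2)), LipschitzLMI.subdiagBlock V 0 j = 0 := fun _ => rfl
  simp only [h0, Matrix.zero_apply, zero_mul, Finset.sum_const_zero, mul_zero, zero_add]
  refine Finset.sum_congr rfl fun k _ => Finset.sum_congr rfl fun a _ => ?_
  congr 1
  rw [Finset.sum_eq_single k.castSucc]
  · simp [LipschitzLMI.subdiagBlock]
  · intro j _ hj
    simp [LipschitzLMI.subdiagBlock, hj.symm]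
  · simp

theorem dotProduct_blockDiagonal_mulVec {L : ℕ} {n : Fin (L + 2) → ℕ}
    (D : ∀ i : Fin (L + 2), Matrix (Fin (n i)) (Fin (n i)) ℝ)
    (z : (Σ i : Fin (L + 2), Fin (n i)) → ℝ) :
    z ⬝ᵥ (Matrix.blockDiagonal' D *ᵥ z) =
      ∑ i, (fun a => z ⟨i, a⟩) ⬝ᵥ (D i *ᵥ fun a => z ⟨i, a⟩) := by
  simp only [dotProduct, Matrix.mulVec, Fintype.sum_sigma]
  refine Finset.sum_congr rfl fun k _ => Finset.sum_congr rfl fun a _ => ?_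
  congr 1
  rw [Finset.sum_eq_single k]
  · simp
  · intro j _ hj
    simp [Matrix.blockDiagonal'_apply_ne D _ _ hj.symm]
  · simp

/-! ### The Cayley transform and its image. -/

/-- Every pair `A`, `B` with `A Aᵀ + B Bᵀ = 1` and `1 + Aᵀ` invertible arises from the Cayley
transform. -/
theorem exists_cayley_eq_fromRows {m p : Type*} [Fintype m] [DecidableEq m] [Fintype p]
    {A : Matrix m m ℝ} {B : Matrix m p ℝ} (h : A * Aᵀ + B * Bᵀ = 1) (hA : IsUnit (1 + Aᵀ)) :
    ∃ (X : Matrix m m ℝ) (Y : Matrix p m ℝ), cayley X Y = Matrix.fromRows Aᵀ Bᵀ := by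
  set C := (1 + Aᵀ)⁻¹ with hC
  have hd := (Matrix.isUnit_iff_isUnit_det _).1 hA
  have h1 : (1 + Aᵀ) * C = 1 := Matrix.mul_nonsing_inv _ hd
  have h2 : C * (1 + Aᵀ) = 1 := Matrix.nonsing_inv_mul _ hd
  have h1' : Cᵀ * (1 + A) = 1 := by simpa using congrArg Matrix.transpose h1
  have key : Cᵀ + C - 1 = Cᵀ * (B * Bᵀ) * C := by
    have e : B * Bᵀ = (1 + Aᵀ) + (1 + A) - (1 + A) * (1 + Aᵀ) := by
      rw [← sub_eq_iff_eq_add'.2 h.symm]; noncomm_ring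
    rw [e, mul_sub, sub_mul, mul_add, add_mul, mul_assoc, h1, h1', mul_one, one_mul,
      ← mul_assoc, h1', one_mul, h1]
  -- Solving `1 + Z = 2C` and `-2Y(1 + Z)⁻¹ = Bᵀ` gives `Z = 2C - 1` and `Y = -BᵀC`. By `key`, `YᵀY
  -- = C + Cᵀ - 1`, so `X` only has to supply the skew part `C - Cᵀ`.
  have hZ : cayleyZ ((1 / 2 : ℝ) • (C - Cᵀ)) (-(Bᵀ * C)) = 2 • C - 1 := by
    have : (-(Bᵀ * C))ᵀ * (-(Bᵀ * C)) = Cᵀ * (B * Bᵀ) * C := by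
      simp [Matrix.mul_assoc]
    rw [cayleyZ, this, ← key, Matrix.transpose_smul, Matrix.transpose_sub,
      Matrix.transpose_transpose]
    module
  refine ⟨(1 / 2 : ℝ) • (C - Cᵀ), -(Bᵀ * C), ?_⟩
  rw [cayley, hZ]
  have e1 : (1 + (2 • C - 1) : Matrix m m ℝ) = (2:ℝ) • C := by
    rw [two_smul, two_smul]; abel
  have e2 : ((2:ℝ) • C)⁻¹ = (1/2 : ℝ) • (1 + Aᵀ) := by
    apply Matrix.inv_eq_left_inv
    rw [smul_mul_smul_comm, h1]; norm_num
  rw [e1, e2]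
  congr 1
  · have : (1 - (2 • C - 1) : Matrix m m ℝ) = (2:ℝ) • (1 - C) := by
      rw [two_smul, two_smul]; abel
    rw [this, smul_mul_smul_comm, mul_sub, h1]; norm_num
  · rw [Matrix.neg_mul, Matrix.mul_smul, Matrix.mul_assoc, h2, Matrix.mul_one, smul_neg, smul_smul]
    norm_num

/-- The Cayley transform has orthonormal columns. -/
theorem cayley_transpose_mul_self {m p : Type*} [Fintype m] [DecidableEq m] [Fintype p]
    (X : Matrix m m ℝ) (Y : Matrix p m ℝ) :
    (cayley X Y)ᵀ * cayley X Y = 1 := by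
  set Z := cayleyZ X Y with hZ
  have hd := (Matrix.isUnit_iff_isUnit_det _).1 (isUnit_one_add_cayleyZ X Y)
  set C := (1 + Z)⁻¹ with hC
  have h1 : (1 + Z) * C = 1 := Matrix.mul_nonsing_inv _ hd
  have h2 : C * (1 + Z) = 1 := Matrix.nonsing_inv_mul _ hd
  have h1' : Cᵀ * (1 + Zᵀ) = 1 := by simpa using congrArg Matrix.transpose h1
  have hY : Yᵀ * Y * 2 = Z + Zᵀ := by
    simp [hZ, cayleyZ, mul_two]; abel
  have hcomm : C * (1 - Z) = (1 - Z) * C := by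
    have : (1 - Z : Matrix m m ℝ) = 2 - (1 + Z) := by
      rw [← one_add_one_eq_two]; abel
    rw [this, mul_sub, sub_mul, h1, h2, mul_two, two_mul]
  have : (cayley X Y)ᵀ * cayley X Y =
      (C * (1 - Z))ᵀ * (C * (1 - Z)) + 4 • (Cᵀ * (Yᵀ * Y) * C) := by
    rw [cayley, Matrix.transpose_fromRows, Matrix.fromCols_mul_fromRows, ← hZ, ← hC]
    congr 1
    rw [Matrix.transpose_smul, Matrix.smul_mul, Matrix.mul_smul, smul_smul, Matrix.transpose_mul]
    simp only [Matrix.mul_assoc]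
    rw [← Nat.cast_smul_eq_nsmul ℝ]
    norm_num
  rw [this, hcomm, Matrix.transpose_mul, Matrix.transpose_sub, Matrix.transpose_one]
  have e : (4 • (Cᵀ * (Yᵀ * Y) * C)) = Cᵀ * (2 * (Z + Zᵀ)) * C := by
    rw [← hY]; noncomm_ring
  rw [e]
  -- The identity `(1 - Zᵀ)(1 - Z) + 2(Z + Zᵀ) = (1 + Zᵀ)(1 + Z)`.
  calc _ = Cᵀ * ((1 + Zᵀ) * (1 + Z)) * C := by noncomm_ring
    _ = (Cᵀ * (1 + Zᵀ)) * ((1 + Z) * C) := by noncomm_ring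
    _ = 1 := by rw [h1, h1', one_mul]

/-! ### Block Cholesky factorization of tridiagonal forms. -/

theorem Matrix.PosSemidef.transpose_eq {m : Type*} {A : Matrix m m ℝ} (hA : A.PosSemidef) :
    Aᵀ = A := by
  rw [← Matrix.conjTranspose_eq_transpose_of_trivial]
  exact hA.isHermitian.eq

theorem Matrix.dotProduct_self_transpose_mulVec {m p : Type*} [Fintype m] [Fintype p]
    (M : Matrix m p ℝ) (y : m → ℝ) :
    (Mᵀ *ᵥ y) ⬝ᵥ (Mᵀ *ᵥ y) = y ⬝ᵥ ((M * Mᵀ) *ᵥ y) := by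
  rw [← Matrix.mulVec_mulVec, Matrix.dotProduct_mulVec y, ← Matrix.mulVec_transpose]

/-- One step of the block Cholesky factorization: if `|Aᵀ x|² - 2 yᵀ U x` is bounded below in `x`
for each `y`, then `U = B Aᵀ` for some `B` such that `-|Bᵀ y|²` is the largest lower bound. -/
theorem exists_factor_of_form_nonneg {m p : Type*} [Fintype m] [DecidableEq m] [Fintype p]
    {A : Matrix m m ℝ} (hA : A.PosSemidef) (U : Matrix p m ℝ)
    (hU : ∀ y : p → ℝ, ∃ r : ℝ, ∀ x : m → ℝ,
      0 ≤ (Aᵀ *ᵥ x) ⬝ᵥ (Aᵀ *ᵥ x) - 2 * (y ⬝ᵥ (U *ᵥ x)) + r) :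
    ∃ B : Matrix p m ℝ, U = B * Aᵀ ∧ ∀ (y : p → ℝ) (r : ℝ),
      (∀ x : m → ℝ, 0 ≤ (Aᵀ *ᵥ x) ⬝ᵥ (Aᵀ *ᵥ x) - 2 * (y ⬝ᵥ (U *ᵥ x)) + r) →
        (Bᵀ *ᵥ y) ⬝ᵥ (Bᵀ *ᵥ y) ≤ r := by
  have hT : Aᵀ = A := hA.transpose_eq
  simp only [hT] at hU ⊢
  obtain ⟨P, hP, hAPA, hPAP, hc⟩ := hA.isHermitian.exists_pseudoinverse
  have hker : ∀ x, A *ᵥ x = 0 → U *ᵥ x = 0 := by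
    intro x hx
    set y := U *ᵥ x with hy
    obtain ⟨r, hr⟩ := hU y
    by_contra h0
    have hpos : 0 < y ⬝ᵥ y :=
      lt_of_le_of_ne (Finset.sum_nonneg fun i _ => mul_self_nonneg _)
        fun h => h0 (dotProduct_self_eq_zero.1 h.symm)
    -- On `ker A` the form is affine in `x`; this multiple gives the value `r - 2(|r| + 1) < 0`.
    have := hr (((|r| + 1) / (y ⬝ᵥ y)) • x)
    rw [Matrix.mulVec_smul, Matrix.mulVec_smul, hx, ← hy, smul_zero, dotProduct_zero,
      dotProduct_smul, smul_eq_mul, div_mul_cancel₀ _ hpos.ne'] at this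
    linarith [le_abs_self r, abs_nonneg r]
  refine ⟨U * P, ?_, ?_⟩
  -- The range of `1 - PA` lies in `ker A`, hence in `ker U`.
  · apply Matrix.ext_of_mulVec_single
    intro i
    have := hker ((1 - P * A) *ᵥ Pi.single i 1) (by
      rw [Matrix.mulVec_mulVec, mul_sub, mul_one, ← mul_assoc, hAPA, sub_self, Matrix.zero_mulVec])
    rw [Matrix.sub_mulVec, Matrix.one_mulVec, Matrix.mulVec_sub, sub_eq_zero,
      Matrix.mulVec_mulVec, ← Matrix.mul_assoc] at this
    exact this
  · intro y r h
    -- The minimizer over `x`: it solves `A²x = Uᵀy` in the pseudoinverse sense, and there the form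
    -- equals `r - |(UP)ᵀy|²`.
    have := h ((P * P) *ᵥ (Uᵀ *ᵥ y))
    have e1 : A *ᵥ ((P * P) *ᵥ (Uᵀ *ᵥ y)) = (U * P)ᵀ *ᵥ y := by
      rw [Matrix.mulVec_mulVec, Matrix.mulVec_mulVec, Matrix.transpose_mul, hP, ← mul_assoc, hc,
        hPAP]
    have e2 : y ⬝ᵥ (U *ᵥ ((P * P) *ᵥ (Uᵀ *ᵥ y))) = ((U * P)ᵀ *ᵥ y) ⬝ᵥ ((U * P)ᵀ *ᵥ y) := by
      rw [Matrix.dotProduct_self_transpose_mulVec, Matrix.mulVec_mulVec, Matrix.mulVec_mulVec,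
        Matrix.transpose_mul, hP]
      simp only [Matrix.mul_assoc]
    rw [e1, e2] at this
    linarith

/-- Block Cholesky factorization, with positive semidefinite diagonal blocks, of a block tridiagonal
form whose diagonal blocks after the first one are identities. -/
theorem exists_chain_factorization (L : ℕ) : ∀ (n : Fin (L + 1) → ℕ)
    (U : ∀ k : Fin L, Matrix (Fin (n k.succ)) (Fin (n k.castSucc)) ℝ)
    (A₀ : Matrix (Fin (n 0)) (Fin (n 0)) ℝ), A₀.PosSemidef →
    (∀ x : ∀ i, Fin (n i) → ℝ, 0 ≤ (A₀ᵀ *ᵥ x 0) ⬝ᵥ (A₀ᵀ *ᵥ x 0) +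
      ∑ k : Fin L, (x k.succ ⬝ᵥ x k.succ - 2 * (x k.succ ⬝ᵥ (U k *ᵥ x k.castSucc)))) →
    ∃ (A : ∀ i, Matrix (Fin (n i)) (Fin (n i)) ℝ)
      (B : ∀ k : Fin L, Matrix (Fin (n k.succ)) (Fin (n k.castSucc)) ℝ),
      A 0 = A₀ ∧ (∀ i, (A i).PosSemidef) ∧
      (∀ k : Fin L, A k.succ * (A k.succ)ᵀ + B k * (B k)ᵀ = 1) ∧
      ∀ k : Fin L, U k = B k * (A k.castSucc)ᵀ := by
  induction L with
  | zero =>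
    intro n U A₀ hA₀ _
    refine ⟨fun i => Fin.cases (motive := fun i => Matrix (Fin (n i)) (Fin (n i)) ℝ) A₀
      (fun k => k.elim0) i, fun k => k.elim0, rfl, ?_, fun k => k.elim0, fun k => k.elim0⟩
    intro i
    induction i using Fin.cases with
    | zero => exact hA₀
    | succ k => exact k.elim0
  | succ L ih =>
    intro n U A₀ hA₀ h
    have split : ∀ (x₀ : Fin (n 0) → ℝ) (y : ∀ i : Fin (L + 1), Fin (n i.succ) → ℝ),
        0 ≤ (A₀ᵀ *ᵥ x₀) ⬝ᵥ (A₀ᵀ *ᵥ x₀) - 2 * (y 0 ⬝ᵥ (U 0 *ᵥ x₀)) +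
          (y 0 ⬝ᵥ y 0 + ∑ k : Fin L, (y k.succ ⬝ᵥ y k.succ -
            2 * (y k.succ ⬝ᵥ (U k.succ *ᵥ y k.castSucc)))) := by
      intro x₀ y
      have := h (fun i => Fin.cases (motive := fun i => Fin (n i) → ℝ) x₀ y i)
      rw [Fin.sum_univ_succ] at this
      refine this.trans_eq ?_
      simp only [Fin.cases_zero, Fin.cases_succ, Fin.castSucc_zero, ← Fin.succ_castSucc]
      ring
    obtain ⟨B₀, hB₀, hle⟩ := exists_factor_of_form_nonneg hA₀ (U 0) fun y =>
      ⟨_, fun x => split x (fun i => Fin.cases (motive := fun i : Fin (L + 1) => Fin (n i.succ) → ℝ)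
        y (fun _ => 0) i)⟩
    have hS : (1 - B₀ * B₀ᵀ).PosSemidef := by
      refine Matrix.PosSemidef.of_dotProduct_mulVec_nonneg ?_ ?_
      · rw [Matrix.IsHermitian, Matrix.conjTranspose_eq_transpose_of_trivial,
          Matrix.transpose_sub, Matrix.transpose_one, Matrix.transpose_mul,
          Matrix.transpose_transpose]
      · intro y
        -- With every later variable zero, the constant term is `|y|²`, whence `|B₀ᵀy|² ≤ |y|²`.
        have := hle y _ fun x => split x (fun i =>
          Fin.cases (motive := fun i : Fin (L + 1) => Fin (n i.succ) → ℝ) y (fun _ => 0) i)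
        rw [Matrix.dotProduct_self_transpose_mulVec] at this
        rw [star_trivial, Matrix.sub_mulVec, Matrix.one_mulVec, dotProduct_sub, sub_nonneg]
        simpa using this
    obtain ⟨A₁, hA₁, hA₁S⟩ := hS.exists_sqrt
    have hA₁T : A₁ᵀ = A₁ := hA₁.transpose_eq
    -- Eliminating `x₀` turns `|y₀|²` into `|y₀|² - |B₀ᵀy₀|² = |A₁ᵀy₀|²`, a form of the same shape
    -- with one variable fewer.
    obtain ⟨A, B, hA0, hApos, hAB, hU⟩ := ih (fun i => n i.succ) (fun k => U k.succ) A₁ hA₁ (by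
      intro y
      have := hle (y 0) _ fun x => split x y
      rw [Matrix.dotProduct_self_transpose_mulVec] at this ⊢
      rw [hA₁T, hA₁S, Matrix.sub_mulVec, Matrix.one_mulVec, dotProduct_sub]
      linarith)
    refine ⟨fun i => Fin.cases (motive := fun i => Matrix (Fin (n i)) (Fin (n i)) ℝ) A₀ A i,
      fun k => Fin.cases (motive := fun k : Fin (L + 1) =>
        Matrix (Fin (n k.succ)) (Fin (n k.castSucc)) ℝ) B₀ B k, rfl, ?_, ?_, ?_⟩
    · intro i
      induction i using Fin.cases with
      | zero => exact hA₀
      | succ k => exact hApos k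
    · intro k
      induction k using Fin.cases with
      | zero =>
        change A 0 * (A 0)ᵀ + B₀ * B₀ᵀ = 1
        rw [hA0, hA₁T, hA₁S, sub_add_cancel]
      | succ k => exact hAB k
    · intro k
      induction k using Fin.cases with
      | zero => exact hB₀
      | succ k => exact hU k

/-- A block tridiagonal form with a block Cholesky factorization is a sum of squares. -/
theorem chain_form_nonneg {L : ℕ} {n : Fin (L + 1) → ℕ}
    (A : ∀ i, Matrix (Fin (n i)) (Fin (n i)) ℝ)
    (B : ∀ k : Fin L, Matrix (Fin (n k.succ)) (Fin (n k.castSucc)) ℝ) (hA₀ : A 0 = 1)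
    (hAB : ∀ k : Fin L, A k.succ * (A k.succ)ᵀ + B k * (B k)ᵀ = 1) (x : ∀ i, Fin (n i) → ℝ) :
    0 ≤ x 0 ⬝ᵥ x 0 + ∑ k : Fin L, (x k.succ ⬝ᵥ x k.succ -
      2 * (x k.succ ⬝ᵥ ((B k * (A k.castSucc)ᵀ) *ᵥ x k.castSucc))) := by
  set a : ∀ i, Fin (n i) → ℝ := fun i => (A i)ᵀ *ᵥ x i with ha
  have ha0 : a 0 = x 0 := by simp [ha, hA₀]
  have hself : ∀ k : Fin L, x k.succ ⬝ᵥ x k.succ = a k.succ ⬝ᵥ a k.succ +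
      ((B k)ᵀ *ᵥ x k.succ) ⬝ᵥ ((B k)ᵀ *ᵥ x k.succ) := by
    intro k
    rw [ha, Matrix.dotProduct_self_transpose_mulVec, Matrix.dotProduct_self_transpose_mulVec,
      ← dotProduct_add, ← Matrix.add_mulVec, hAB, Matrix.one_mulVec]
  have hcross : ∀ k : Fin L, x k.succ ⬝ᵥ ((B k * (A k.castSucc)ᵀ) *ᵥ x k.castSucc) =
      ((B k)ᵀ *ᵥ x k.succ) ⬝ᵥ a k.castSucc := by
    intro k
    rw [ha, ← Matrix.mulVec_mulVec, Matrix.dotProduct_mulVec, ← Matrix.mulVec_transpose]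
  -- Splitting off the first or the last term of one sum performs the telescoping; only `|a_L|²`
  -- survives.
  have htel := (Fin.sum_univ_succ fun i => a i ⬝ᵥ a i).symm.trans
    (Fin.sum_univ_castSucc fun i => a i ⬝ᵥ a i)
  have hsq : ∀ k : Fin L, x k.succ ⬝ᵥ x k.succ -
      2 * (x k.succ ⬝ᵥ ((B k * (A k.castSucc)ᵀ) *ᵥ x k.castSucc)) =
      ((B k)ᵀ *ᵥ x k.succ - a k.castSucc) ⬝ᵥ ((B k)ᵀ *ᵥ x k.succ - a k.castSucc) +
        a k.succ ⬝ᵥ a k.succ - a k.castSucc ⬝ᵥ a k.castSucc := by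
    intro k
    rw [hself, hcross, dotProduct_sub, sub_dotProduct, sub_dotProduct,
      dotProduct_comm (a k.castSucc) ((B k)ᵀ *ᵥ x k.succ)]
    ring
  have hnn : ∀ {ι : Type} [Fintype ι] (v : ι → ℝ), 0 ≤ v ⬝ᵥ v := fun v =>
    Finset.sum_nonneg fun i _ => mul_self_nonneg (v i)
  rw [Finset.sum_congr rfl fun k _ => hsq k, Finset.sum_sub_distrib, Finset.sum_add_distrib, ← ha0]
  have hs := Finset.sum_nonneg fun (k : Fin L) (_ : k ∈ Finset.univ) =>
    hnn ((B k)ᵀ *ᵥ x k.succ - a k.castSucc)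
  have hl := hnn (a (Fin.last L))
  linarith

/-! ### Normalizing the diagonal blocks of `H`. -/

namespace LipschitzLMI

variable {L : ℕ} {n : Fin (L + 2) → ℕ}

/-- The diagonals of the square roots of half the diagonal blocks of `H`. -/
noncomputable def scale (γ : ℝ) (lam : ∀ j : Fin L, Fin (n j.castSucc.succ) → ℝ)
    (i : Fin (L + 2)) : Fin (n i) → ℝ :=
  Fin.cases (motive := fun i : Fin (L + 2) => Fin (n i) → ℝ) (fun _ => √(γ / 2))
    (fun k => Fin.lastCases (motive := fun k : Fin (L + 1) => Fin (n k.succ) → ℝ)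
      (fun _ => √(γ / 2)) (fun j a => √(lam j a)) k) i

theorem scale_last (γ : ℝ) (lam : ∀ j : Fin L, Fin (n j.castSucc.succ) → ℝ) :
    scale γ lam (Fin.last L).succ = fun _ => √(γ / 2) := by
  simp only [scale, Fin.cases_succ, Fin.lastCases_last]

theorem scale_pos {γ : ℝ} (hγ : 0 < γ) {lam : ∀ j : Fin L, Fin (n j.castSucc.succ) → ℝ}
    (hlam : ∀ j a, 0 < lam j a) (i : Fin (L + 2)) (a : Fin (n i)) : 0 < scale γ lam i a := by
  induction i using Fin.cases with
  | zero => exact Real.sqrt_pos.2 (half_pos hγ)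
  | succ k =>
    induction k using Fin.lastCases with
    | last =>
      rw [scale_last]
      exact Real.sqrt_pos.2 (half_pos hγ)
    | cast j => simpa [scale] using hlam j a

theorem diagBlock_eq {γ : ℝ} (hγ : 0 < γ) {lam : ∀ j : Fin L, Fin (n j.castSucc.succ) → ℝ}
    (hlam : ∀ j a, 0 < lam j a) (i : Fin (L + 2)) :
    diagBlock γ lam i = (2 : ℝ) • Matrix.diagonal fun a => scale γ lam i a * scale γ lam i a := by
  have hγ' : γ / 2 = √(γ / 2) * √(γ / 2) := (Real.mul_self_sqrt (half_pos hγ).le).symm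
  have hconst : ∀ m : ℕ, (γ • 1 : Matrix (Fin m) (Fin m) ℝ) =
      (2 : ℝ) • Matrix.diagonal fun _ => √(γ / 2) * √(γ / 2) := by
    intro m
    rw [← hγ', ← Matrix.smul_one_eq_diagonal, smul_smul, mul_div_cancel₀ _ two_ne_zero]
  induction i using Fin.cases with
  | zero => exact hconst _
  | succ k =>
    induction k using Fin.lastCases with
    | last =>
      rw [scale_last]
      simp only [diagBlock, Fin.cases_succ, Fin.lastCases_last]
      exact hconst _
    | cast j => simp [diagBlock, scale, Real.mul_self_sqrt (hlam j _).le]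

theorem dotProduct_H_mulVec (γ : ℝ) (f : FeedforwardNetwork L n)
    (lam : ∀ j : Fin L, Fin (n j.castSucc.succ) → ℝ) (z : (Σ i : Fin (L + 2), Fin (n i)) → ℝ) :
    z ⬝ᵥ (H γ f lam *ᵥ z) =
      ∑ i, (fun a => z ⟨i, a⟩) ⬝ᵥ (diagBlock γ lam i *ᵥ fun a => z ⟨i, a⟩) -
      2 * ∑ k : Fin (L + 1), (fun a => z ⟨k.succ, a⟩) ⬝ᵥ
        (f.scaledWeight lam k *ᵥ fun a => z ⟨k.castSucc, a⟩) := by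
  have ht : z ⬝ᵥ ((subdiag (f.scaledWeight lam))ᵀ *ᵥ z) =
      z ⬝ᵥ (subdiag (f.scaledWeight lam) *ᵥ z) := by
    rw [Matrix.mulVec_transpose, dotProduct_comm, ← Matrix.dotProduct_mulVec]
  rw [H, Matrix.sub_mulVec, Matrix.sub_mulVec, dotProduct_sub, dotProduct_sub, ht, dotProduct_subdiag_mulVec,
    dotProduct_blockDiagonal_mulVec]
  ring

/-- If `Ŵ_k = 2 Φ_{k+1} U_k Φ_k`, where `2 Φ_i ^ 2` are the diagonal blocks of `H`, then `H` is
positive semidefinite iff the block tridiagonal form with identity diagonal blocks and subdiagonal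
blocks `-U_k` is nonnegative. -/
theorem posSemidef_H_iff {γ : ℝ} (hγ : 0 < γ) (f : FeedforwardNetwork L n)
    {lam : ∀ j : Fin L, Fin (n j.castSucc.succ) → ℝ} (hlam : ∀ j a, 0 < lam j a)
    (U : ∀ k : Fin (L + 1), Matrix (Fin (n k.succ)) (Fin (n k.castSucc)) ℝ)
    (hU : ∀ k, f.scaledWeight lam k = (2 : ℝ) • (Matrix.diagonal (scale γ lam k.succ) * U k *
      Matrix.diagonal (scale γ lam k.castSucc))) :
    (H γ f lam).PosSemidef ↔ ∀ x : ∀ i, Fin (n i) → ℝ, 0 ≤ x 0 ⬝ᵥ x 0 +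
      ∑ k : Fin (L + 1), (x k.succ ⬝ᵥ x k.succ - 2 * (x k.succ ⬝ᵥ (U k *ᵥ x k.castSucc))) := by
  have hdiag : ∀ {m : ℕ} (d v w : Fin m → ℝ),
      v ⬝ᵥ (Matrix.diagonal d *ᵥ w) = (fun a => d a * v a) ⬝ᵥ w := by
    intro m d v w
    simp only [dotProduct, Matrix.mulVec_diagonal]
    exact Finset.sum_congr rfl fun a _ => by ring
  have hform : ∀ z : (Σ i : Fin (L + 2), Fin (n i)) → ℝ, z ⬝ᵥ (H γ f lam *ᵥ z) =
      2 * ((fun a => scale γ lam 0 a * z ⟨0, a⟩) ⬝ᵥ (fun a => scale γ lam 0 a * z ⟨0, a⟩) +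
      ∑ k : Fin (L + 1), ((fun a => scale γ lam k.succ a * z ⟨k.succ, a⟩) ⬝ᵥ
        (fun a => scale γ lam k.succ a * z ⟨k.succ, a⟩) -
        2 * ((fun a => scale γ lam k.succ a * z ⟨k.succ, a⟩) ⬝ᵥ
          (U k *ᵥ (fun a => scale γ lam k.castSucc a * z ⟨k.castSucc, a⟩))))) := by
    intro z
    have h1 : ∀ i, (fun a => z ⟨i, a⟩) ⬝ᵥ (diagBlock γ lam i *ᵥ fun a => z ⟨i, a⟩) =
        2 * ((fun a => scale γ lam i a * z ⟨i, a⟩) ⬝ᵥ (fun a => scale γ lam i a * z ⟨i, a⟩)) := by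
      intro i
      rw [diagBlock_eq hγ hlam, Matrix.smul_mulVec, dotProduct_smul, smul_eq_mul, hdiag]
      simp only [dotProduct]
      exact congrArg _ (Finset.sum_congr rfl fun a _ => by ring)
    have h2 : ∀ k : Fin (L + 1), (fun a => z ⟨k.succ, a⟩) ⬝ᵥ
        (f.scaledWeight lam k *ᵥ fun a => z ⟨k.castSucc, a⟩) =
        2 * ((fun a => scale γ lam k.succ a * z ⟨k.succ, a⟩) ⬝ᵥ
          (U k *ᵥ (fun a => scale γ lam k.castSucc a * z ⟨k.castSucc, a⟩))) := by
      intro k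
      rw [hU, Matrix.smul_mulVec, dotProduct_smul, smul_eq_mul, ← Matrix.mulVec_mulVec,
        ← Matrix.mulVec_mulVec, hdiag]
      congr 4
      funext a
      rw [Matrix.mulVec_diagonal]
    rw [dotProduct_H_mulVec, Finset.sum_congr rfl fun i _ => h1 i, Finset.sum_congr rfl fun i _ => h2 i,
      Fin.sum_univ_succ, Finset.sum_sub_distrib, ← Finset.mul_sum, ← Finset.mul_sum]
    ring
  have hherm : (H γ f lam).IsHermitian := by
    have hD : (Matrix.blockDiagonal' (diagBlock γ lam))ᵀ =
        Matrix.blockDiagonal' (diagBlock γ lam) := by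
      rw [Matrix.blockDiagonal'_transpose]
      congr 1
      funext i
      rw [diagBlock_eq hγ hlam, Matrix.transpose_smul, Matrix.diagonal_transpose]
    rw [Matrix.IsHermitian, Matrix.conjTranspose_eq_transpose_of_trivial, H,
      Matrix.transpose_sub, Matrix.transpose_sub, Matrix.transpose_transpose, hD]
    abel
  rw [Matrix.posSemidef_iff_dotProduct_mulVec, and_iff_right hherm]
  constructor
  · intro h x
    have := h fun p => (scale γ lam p.1 p.2)⁻¹ * x p.1 p.2
    rw [star_trivial, hform] at this
    simp only [mul_inv_cancel_left₀ (scale_pos hγ hlam _ _).ne'] at this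
    linarith
  · intro h z
    rw [star_trivial, hform]
    exact mul_nonneg zero_le_two (h fun i a => scale γ lam i a * z ⟨i, a⟩)

/-- The last index is excluded: there `Ψ_L = √(2/γ) I`, while the scale is `√(γ/2)`. -/
theorem prevΨ_castSucc {γ : ℝ} {lam : ∀ j : Fin L, Fin (n j.castSucc.succ) → ℝ}
    (θ : DirectParams L n) (hθ : ∀ j a, √(lam j a) = Real.exp (θ.d j a)) (k : Fin (L + 1)) :
    θ.prevΨ γ k.castSucc = Matrix.diagonal (scale γ lam k.castSucc) := by
  induction k using Fin.cases with
  | zero => exact Matrix.smul_one_eq_diagonal _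
  | succ j =>
    rw [← Fin.succ_castSucc]
    simp [DirectParams.prevΨ, DirectParams.Ψ, scale, hθ]

/-- The parameterization of the weights, in terms of the scaled weights `Ŵ_k`. -/
theorem weight_eq_iff {γ : ℝ} (hγ : 0 < γ) (f : FeedforwardNetwork L n)
    {lam : ∀ j : Fin L, Fin (n j.castSucc.succ) → ℝ} (hlam : ∀ j a, 0 < lam j a)
    (θ : DirectParams L n) (hθ : ∀ j a, √(lam j a) = Real.exp (θ.d j a)) (k : Fin (L + 1)) :
    f.W k = θ.weight γ k ↔
      f.scaledWeight lam k = (2 : ℝ) • (Matrix.diagonal (scale γ lam k.succ) *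
        (θ.B k * (θ.prevA k.castSucc)ᵀ) * Matrix.diagonal (scale γ lam k.castSucc)) := by
  rw [DirectParams.weight, prevΨ_castSucc θ hθ]
  generalize θ.prevA k.castSucc = A'
  generalize scale γ lam k.castSucc = s
  have hγ2 : 0 < γ / 2 := half_pos hγ
  induction k using Fin.lastCases with
  | last =>
    -- Since `Ŵ_L = W_L` carries no multiplier, `Ψ_L⁻¹` itself must be the left scaling. For `k < L`
    -- that scaling is instead `Λ_k Ψ_k⁻¹ = Ψ_k`.
    have e : (θ.Ψ γ (Fin.last L))⁻¹ = Matrix.diagonal (scale γ lam (Fin.last L).succ) := by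
      apply Matrix.inv_eq_left_inv
      have h1 : √(γ / 2) * √(2 / γ) = 1 := by
        rw [← Real.sqrt_mul hγ2.le, div_mul_div_cancel₀ two_ne_zero, div_self hγ.ne', Real.sqrt_one]
      rw [scale_last, ← Matrix.smul_one_eq_diagonal]
      simp only [DirectParams.Ψ, Fin.lastCases_last]
      rw [smul_mul_smul_comm, h1, one_smul, mul_one]
    rw [e]
    simp [FeedforwardNetwork.scaledWeight, Matrix.mul_assoc]
  | cast j =>
    have hs : scale γ lam j.castSucc.succ = fun a => √(lam j a) := by simp [scale]
    have hΨ : θ.Ψ γ j.castSucc = Matrix.diagonal fun a => √(lam j a) := by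
      simp [DirectParams.Ψ, hθ]
    have hW : f.scaledWeight lam j.castSucc = Matrix.diagonal (lam j) * f.W j.castSucc := by
      simp [FeedforwardNetwork.scaledWeight]
    rw [hs, hΨ, hW]
    set D := Matrix.diagonal fun a => √(lam j a) with hD
    have hDD : Matrix.diagonal (lam j) = D * D := by
      rw [hD, Matrix.diagonal_mul_diagonal]
      simp only [Real.mul_self_sqrt (hlam j _).le]
    have hdet : IsUnit D.det := by
      rw [hD, Matrix.det_diagonal, isUnit_iff_ne_zero, Finset.prod_ne_zero_iff]
      exact fun a _ => (Real.sqrt_pos.2 (hlam j a)).ne'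
    have h1 : D * D⁻¹ = 1 := Matrix.mul_nonsing_inv _ hdet
    have h2 : D⁻¹ * D = 1 := Matrix.nonsing_inv_mul _ hdet
    rw [hDD]
    constructor
    · intro h
      rw [h, Matrix.mul_smul]
      simp only [Matrix.mul_assoc]
      rw [← Matrix.mul_assoc D D⁻¹, h1, Matrix.one_mul]
    · intro h
      have h3 := congrArg (fun M => D⁻¹ * (D⁻¹ * M)) h
      simp only [Matrix.mul_smul, Matrix.mul_assoc] at h3
      rw [← Matrix.mul_assoc D⁻¹ D, h2, Matrix.one_mul, ← Matrix.mul_assoc D⁻¹ D, h2,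
        Matrix.one_mul, ← Matrix.mul_assoc D⁻¹ D, h2, Matrix.one_mul] at h3
      simpa only [Matrix.mul_assoc] using h3

end LipschitzLMI

/-! ### The equivalence. -/

theorem DirectParams.prevA_mul_transpose_add {L : ℕ} {n : Fin (L + 2) → ℕ} (θ : DirectParams L n)
    (k : Fin (L + 1)) :
    θ.prevA k.succ * (θ.prevA k.succ)ᵀ + θ.B k * (θ.B k)ᵀ = 1 := by
  have h := cayley_transpose_mul_self (θ.X k) (θ.Y k)
  rw [← Matrix.fromRows_toRows (cayley (θ.X k) (θ.Y k)), Matrix.transpose_fromRows,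
    Matrix.fromCols_mul_fromRows] at h
  exact h

open LipschitzLMI in
/-- For a prescribed bound `γ > 0`, a feedforward network satisfies the LMI if and only if its
weights are produced by the direct parameterization from some free parameters. -/
theorem theorem3p2 (L : ℕ) (n : Fin (L + 2) → ℕ) (γ : ℝ) (hγ : 0 < γ)
    (f : FeedforwardNetwork L n) :
    f.SatisfiesLMI γ ↔ ∃ θ : DirectParams L n, ∀ k : Fin (L + 1), f.W k = θ.weight γ k := by
  constructor
  · rintro ⟨lam, hlam, hH⟩
    have hs := fun i => scale_pos (n := n) hγ hlam i
    have hinv : ∀ i, Matrix.diagonal (scale γ lam i) *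
        Matrix.diagonal (fun a => (scale γ lam i a)⁻¹) = 1 := fun i => by
      simp [Matrix.diagonal_mul_diagonal, mul_inv_cancel₀ (hs i _).ne']
    have hinv' : ∀ i, Matrix.diagonal (fun a => (scale γ lam i a)⁻¹) *
        Matrix.diagonal (scale γ lam i) = 1 := fun i => by
      simp [Matrix.diagonal_mul_diagonal, inv_mul_cancel₀ (hs i _).ne']
    set U : ∀ k : Fin (L + 1), Matrix (Fin (n k.succ)) (Fin (n k.castSucc)) ℝ := fun k =>
      (1 / 2 : ℝ) • (Matrix.diagonal (fun a => (scale γ lam k.succ a)⁻¹) * f.scaledWeight lam k *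
        Matrix.diagonal (fun a => (scale γ lam k.castSucc a)⁻¹)) with hUdef
    have hU : ∀ k, f.scaledWeight lam k = (2 : ℝ) • (Matrix.diagonal (scale γ lam k.succ) * U k *
        Matrix.diagonal (scale γ lam k.castSucc)) := by
      intro k
      rw [hUdef, Matrix.mul_smul, Matrix.smul_mul, smul_smul]
      simp only [Matrix.mul_assoc, hinv', Matrix.mul_one]
      rw [← Matrix.mul_assoc, hinv, Matrix.one_mul]
      norm_num
    obtain ⟨A, B, hA₀, hA, hAB, hUAB⟩ := exists_chain_factorization (L + 1) n U 1
      Matrix.PosSemidef.one (by simpa using (posSemidef_H_iff hγ f hlam U hU).1 hH)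
    have hcay : ∀ k : Fin (L + 1), ∃ (X : Matrix (Fin (n k.succ)) (Fin (n k.succ)) ℝ)
        (Y : Matrix (Fin (n k.castSucc)) (Fin (n k.succ)) ℝ),
        cayley X Y = Matrix.fromRows (A k.succ)ᵀ (B k)ᵀ := fun k =>
      exists_cayley_eq_fromRows (hAB k) (Matrix.PosDef.one.add_posSemidef (hA k.succ).transpose).isUnit
    choose X Y hXY using hcay
    -- This `d` makes `Ψ_k² = Λ_k`; the converse takes `Λ_k = Ψ_k²`.
    refine ⟨⟨fun j a => Real.log √(lam j a), X, Y⟩, fun k => ?_⟩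
    rw [weight_eq_iff hγ f hlam _ fun j a => (Real.exp_log (Real.sqrt_pos.2 (hlam j a))).symm, hU,
      hUAB]
    have hB : ∀ d, DirectParams.B ⟨d, X, Y⟩ k = B k := fun d => by
      simp [DirectParams.B, hXY]
    have hprev : ∀ d (i : Fin (L + 2)), DirectParams.prevA ⟨d, X, Y⟩ i = A i := by
      intro d i
      induction i using Fin.cases with
      | zero => exact hA₀.symm
      | succ k => simp [DirectParams.prevA, DirectParams.A, hXY]
    rw [hB, hprev]
  · rintro ⟨θ, hθ⟩
    have hlam : ∀ (j : Fin L) a, 0 < Real.exp (θ.d j a) ^ 2 := fun j a => by positivity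
    refine ⟨fun j a => Real.exp (θ.d j a) ^ 2, hlam, ?_⟩
    have hW := fun k => (weight_eq_iff hγ f hlam θ
      (fun j a => Real.sqrt_sq (Real.exp_pos _).le) k).1 (hθ k)
    rw [posSemidef_H_iff hγ f hlam _ hW]
    exact chain_form_nonneg θ.prevA θ.B rfl θ.prevA_mul_transpose_add
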